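/- Let $n\ge 1$, and let $S_1,\dots,S_N:\mathbb{R}^n\to\mathbb{R}^n$ ($N\ge 1$) be maps of the form $S_i(x)=A_ix+b_i$ with $A_i\in\mathrm{GL}(\mathbb{R},n)$ and $b_i\in\mathbb{R}^n$, each of them a contraction: $|S_i(x)-S_i(y)|\le c_i|x-y|$ for all $x,y$, for some $c_i\in(0,1)$. Let $C\subset\mathbb{R}^n$ be compact, let $F_C$ be the inhomogeneous self-affine set with condensation set $C$, i.e. the non-empty compact set satisfying $$F_C=\bigcup_{i=1}^N S_i(F_C)\cup C,$$ and let $F_\emptyset$ be the homogeneous attractor, i.e. the non-empty compact set satisfying $F_\emptyset=\bigcup_{i=1}^N S_i(F_\emptyset)$. For a non-empty bounded set $F\subset\mathbb{R}^n$ let $\overline{\dim}_{\mathrm B}F=\limsup_{\delta\to0^+}\frac{\log N_\delta(F)}{-\log\delta}$, where $N_\delta(F)$ is the least number of hypercubes of side length $\delta$ needed to cover $F$; put $\overline{\dim}_{\mathrm B}\emptyset=0$. For $A\in\mathrm{GL}(\mathbb{R},n)$ with singular values $\alpha_1\ge\dots\ge\alpha_n>0$ and $t\ge0$ let $\phi^t(A)=\alpha_1\cdots\alpha_{m-1}\,\alpha_m^{\,t-m+1}$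 if $0<t\le n$, where $m\in\mathbb{Z}$ satisfies $m-1<t\le m$; $\phi^0(A)=1$; and $\phi^t(A)=|\det A|^{t/n}$ if $t>n$. For a word $\mathbf i=(i_1,\dots,i_k)\in\{1,\dots,N\}^k$ write $\phi^t(S_{\mathbf i})=\phi^t(A_{i_1}\cdots A_{i_k})$. For each $k\ge1$ let $s_k\ge0$ be the solution of $\sum_{\mathbf i\in\{1,\dots,N\}^k}\phi^{s_k}(S_{\mathbf i})=1$. Then the limit $s=\lim_{k\to\infty}s_k$, called the affinity dimension of the system, is well defined, and $$\max\{\overline{\dim}_{\mathrm B}F_\emptyset,\ \overline{\dim}_{\mathrm B}C\}\ \le\ \overline{\dim}_{\mathrm B}F_C\ \le\ \max\{s,\ \overline{\dim}_{\mathrm B}C\}.$$ -/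

import Mathlib

open Set Filter Topology

namespace InhomSelfAffine

/-- `ℝⁿ` with its Euclidean norm. -/
abbrev E (n : ℕ) : Type := EuclideanSpace ℝ (Fin n)

/-! ### Affine iterated function systems and their attractors

An affine bijection `E n ≃ᵃ[ℝ] E n` is a map `x ↦ A x + b` with `A` invertible; `A` is its
`linear` part, and multiplication in the group of affine bijections is composition. -/

/-- `S` is a contraction with respect to the Euclidean distance. -/
def IsContracting {n : ℕ} (S : E n ≃ᵃ[ℝ] E n) : Prop :=
  ∃ c : ℝ, 0 < c ∧ c < 1 ∧ ∀ x y : E n, dist (S x) (S y) ≤ c * dist x y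

/-- `S₁, …, S_N` is an affine iterated function system: a nonempty finite family of
contracting invertible affine maps. -/
def IsAffineIFS {n N : ℕ} (S : Fin N → (E n ≃ᵃ[ℝ] E n)) : Prop :=
  0 < N ∧ ∀ i, IsContracting (S i)

/-- `F` is the inhomogeneous attractor of the system `S` with condensation set `C`: the nonempty
compact set with `F = S₁(F) ∪ ⋯ ∪ S_N(F) ∪ C`. For `C = ∅` it is the homogeneous attractor. -/
def IsAttractor {n N : ℕ} (S : Fin N → (E n ≃ᵃ[ℝ] E n)) (C F : Set (E n)) : Prop :=
  IsCompact F ∧ F.Nonempty ∧ F = (⋃ i, S i '' F) ∪ C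

/-! ### Upper box dimension -/

/-- `Q` is a closed hypercube of side length `δ`: for some corner `p` and some orthonormal basis
`b`, it is the set of points `p + ∑ j, t j • b j` with all `t j` in `[0, δ]`. -/
def IsHypercube {n : ℕ} (δ : ℝ) (Q : Set (E n)) : Prop :=
  ∃ (p : E n) (b : OrthonormalBasis (Fin n) ℝ (E n)),
    Q = {x | ∀ j, inner ℝ (b j) (x - p) ∈ Icc (0 : ℝ) δ}

/-- `N_δ(F)`: the least number of hypercubes of side length `δ` that cover `F`
(used for bounded `F` and `δ > 0`, where finite covers exist). -/
noncomputable def boxCount {n : ℕ} (δ : ℝ) (F : Set (E n)) : ℕ :=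
  sInf {m : ℕ | ∃ Q : Fin m → Set (E n), (∀ i, IsHypercube δ (Q i)) ∧ F ⊆ ⋃ i, Q i}

/-- The upper box dimension `limsup_{δ → 0⁺} log N_δ(F) / (-log δ)` of a bounded set.
The limsup is taken in the extended reals; the empty set gets dimension `0`. -/
noncomputable def upperBoxDim {n : ℕ} (F : Set (E n)) : EReal :=
  limsup (fun δ : ℝ => ((Real.log (boxCount δ F) / (-Real.log δ) : ℝ) : EReal)) (𝓝[>] 0)

/-! ### Singular value function and affinity dimension -/

/-- The singular value function `φ^t(A)`, `t ≥ 0`. Mathlib's singular values are listed in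
decreasing order from index `0`, so `α_j` is `singularValues (j - 1)`. For `0 < t ≤ n` and
`m = ⌈t⌉` it is `α_1 ⋯ α_{m-1} α_m ^ (t - m + 1)`; `φ^0(A) = 1`; and it is `|det A| ^ (t / n)`
for `t > n`. -/
noncomputable def svf {n : ℕ} (t : ℝ) (A : E n →ₗ[ℝ] E n) : ℝ :=
  if t ≤ 0 then 1
  else if t ≤ n then
    (∏ j ∈ Finset.range (⌈t⌉₊ - 1), A.singularValues j) *
      A.singularValues (⌈t⌉₊ - 1) ^ (t - (⌈t⌉₊ : ℝ) + 1)
  else |LinearMap.det A| ^ (t / n)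

/-- `S_w = S_{w_1} ∘ ⋯ ∘ S_{w_k}` for a word `w` of length `k`. -/
noncomputable def wordMap {n N k : ℕ} (S : Fin N → (E n ≃ᵃ[ℝ] E n)) (w : Fin k → Fin N) : E n ≃ᵃ[ℝ] E n :=
  (List.ofFn fun j => S (w j)).prod

/-- The sum of `φ^t(S_w)` over all words `w` of length `k`. -/
noncomputable def svfSum {n N : ℕ} (S : Fin N → (E n ≃ᵃ[ℝ] E n)) (k : ℕ) (t : ℝ) : ℝ :=
  ∑ w : Fin k → Fin N, svf t ((wordMap S w).linear : E n →ₗ[ℝ] E n)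

/-- `s` is the affinity dimension of `S`: the limit as `k → ∞` of the solutions `σ k ≥ 0`
(`k ≥ 1`) of the equation `svfSum S k (σ k) = 1`. -/
def IsAffinityDim {n N : ℕ} (S : Fin N → (E n ≃ᵃ[ℝ] E n)) (s : ℝ) : Prop :=
  ∃ σ : ℕ → ℝ, (∀ k, 1 ≤ k → 0 ≤ σ k ∧ svfSum S k (σ k) = 1) ∧ Tendsto σ atTop (𝓝 s)

end InhomSelfAffine

namespace InhomSelfAffine

/-! The lower bound is monotonicity of the dimension: `F_C` contains `C`, and it contains the
homogeneous attractor because a point of the latter at maximal distance from `F_C` is, by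
contraction, at distance zero (`IsAttractor.homogeneous_subset`).

For the upper bound, take `t ≤ n` above `s` and the dimension of `C`, and let `σ(w)` be the `⌈t⌉`-th
singular value of `S_w`. Trace a point of `F_C` back through inverse branches until it lands in `C`
or `σ(w)` drops to at most `δ` (`IsAttractor.exists_word`). In the first case the point lies in
`S_w(C)`, covered by covering `C` at scale `δ / σ(w)`; in the second it lies in `S_w(F_C)`, with
`σ(w)` comparable to `δ`. Either way a constant times `δ ^ (-t) * φ^t(S_w)` cubes suffice
(`boxCount_image_le_svf`, `boxCount_image_closedBall_le_svf`). The sum of `φ^t(S_w)` over all words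
converges for `t > s`, so `N_δ(F_C) ≤ K * δ ^ (-t)`.

Both this convergence and the existence of `s` rest on submultiplicativity of `φ^t` (`svf_comp_le`),
which comes from the bound `α_1 ⋯ α_m` on the growth of `m`-dimensional volume (`det_gram_map_le`).
-/

/-! ### Products of singular values -/

/-- A symmetrised form of the Cauchy–Binet formula. -/
theorem factorial_mul_det_transpose_diagonal_mul {m n : ℕ} (V : Matrix (Fin n) (Fin m) ℝ)
    (d : Fin n → ℝ) :
    (m.factorial : ℝ) * (V.transpose * Matrix.diagonal d * V).det =
      ∑ f : Fin m → Fin n, (∏ i, d (f i)) * (V.submatrix f id).det ^ 2 := by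
  have hexp : (V.transpose * Matrix.diagonal d * V).det =
      ∑ f : Fin m → Fin n, (∏ i, V (f i) i * d (f i)) * (V.submatrix f id).det := by
    have hrow : (V.transpose * Matrix.diagonal d * V) =
        fun i => ∑ k, (V k i * d k) • V k := by
      ext i j
      rw [Matrix.mul_apply]
      simp [Matrix.mul_diagonal, Finset.sum_apply]
    have h1 := (Matrix.detRowAlternating (R := ℝ) (n := Fin m)).toMultilinearMap.map_sum
      (fun i (k : Fin n) => (V k i * d k) • V k)
    have h2 : ∀ f : Fin m → Fin n,
        (Matrix.detRowAlternating (R := ℝ) (n := Fin m)).toMultilinearMap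
          (fun i => (V (f i) i * d (f i)) • V (f i)) =
        (∏ i, V (f i) i * d (f i)) * (V.submatrix f id).det := by
      intro f
      rw [MultilinearMap.map_smul_univ]
      rfl
    rw [hrow]
    simp only [h2] at h1
    exact h1
  -- Replacing `f` by `f ∘ τ` fixes the product of the `d`'s and multiplies the minor by `sign τ`.
  -- Summing over all `τ` then rebuilds the Leibniz expansion of a second copy of the minor, whence
  -- the square.
  have hperm : ∀ τ : Equiv.Perm (Fin m), (V.transpose * Matrix.diagonal d * V).det =
      ∑ f : Fin m → Fin n, (∏ i, d (f i)) * (V.submatrix f id).det *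
        (((Equiv.Perm.sign τ : ℤ) : ℝ) * ∏ i, V (f (τ i)) i) := by
    intro τ
    rw [hexp, ← Equiv.sum_comp (Equiv.arrowCongr τ.symm (Equiv.refl (Fin n)))]
    refine Finset.sum_congr rfl fun f _ => ?_
    have e : (Equiv.arrowCongr τ.symm (Equiv.refl (Fin n))) f = f ∘ τ := by
      ext; simp
    rw [e]
    have h1 : (V.submatrix (f ∘ τ) id).det =
        ((Equiv.Perm.sign τ : ℤ) : ℝ) * (V.submatrix f id).det := by
      rw [← Matrix.det_permute τ (V.submatrix f id)]
      rfl
    have h2 : ∏ i, d (f (τ i)) = ∏ i, d (f i) := Equiv.prod_comp τ (fun i => d (f i))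
    simp only [Function.comp, Finset.prod_mul_distrib] at h1 h2 ⊢
    rw [h1, h2]
    ring
  have hsum : ∑ _τ : Equiv.Perm (Fin m), (V.transpose * Matrix.diagonal d * V).det =
      ∑ f : Fin m → Fin n, (∏ i, d (f i)) * (V.submatrix f id).det ^ 2 := by
    rw [Finset.sum_congr rfl fun τ _ => hperm τ, Finset.sum_comm]
    refine Finset.sum_congr rfl fun f _ => ?_
    rw [← Finset.mul_sum, pow_two, ← mul_assoc]
    congr 1
    rw [Matrix.det_apply']
    rfl
  rw [← hsum]
  simp [Fintype.card_perm]

theorem prod_le_prod_range_of_antitone {σ : ℕ → ℝ} (hσ : Antitone σ) (h0 : ∀ i, 0 ≤ σ i)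
    (s : Finset ℕ) : ∏ i ∈ s, σ i ≤ ∏ i ∈ Finset.range s.card, σ i := by
  induction s using Finset.induction_on_max with
  | empty => simp
  | insert a s hs ih =>
    have ha : a ∉ s := fun h => (hs a h).false
    rw [Finset.prod_insert ha, Finset.card_insert_of_notMem ha, Finset.prod_range_succ, mul_comm]
    refine mul_le_mul ih (hσ ?_) (h0 _) (Finset.prod_nonneg fun i _ => h0 i)
    simpa using Finset.card_le_card (fun x hx => Finset.mem_range.2 (hs x hx) : s ⊆ Finset.range a)

/-- Termwise comparison of the symmetrised expansions for `σ` and for constant weight one: the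
squared minors are nonnegative, and they vanish unless `f` is injective, when the weight is a
product of `m` distinct `σ`'s. -/
theorem det_transpose_diagonal_mul_le {m n : ℕ} (V : Matrix (Fin n) (Fin m) ℝ)
    {σ : ℕ → ℝ} (hσ : Antitone σ) (h0 : ∀ i, 0 ≤ σ i) :
    (V.transpose * Matrix.diagonal (fun k : Fin n => σ k) * V).det ≤
      (∏ i ∈ Finset.range m, σ i) * (V.transpose * V).det := by
  have h1 := factorial_mul_det_transpose_diagonal_mul V (fun k : Fin n => σ k)
  have h2 := factorial_mul_det_transpose_diagonal_mul V (fun _ : Fin n => 1)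
  have hd : (Matrix.diagonal fun _ : Fin n => (1 : ℝ)) = 1 := Matrix.diagonal_one
  rw [hd, Matrix.mul_one] at h2
  have hm : (0 : ℝ) < m.factorial := by exact_mod_cast m.factorial_pos
  refine le_of_mul_le_mul_left ?_ hm
  rw [h1, mul_left_comm, h2, Finset.mul_sum]
  refine Finset.sum_le_sum fun f _ => ?_
  by_cases hf : Function.Injective f
  · simp only [Finset.prod_const_one, one_mul]
    refine mul_le_mul_of_nonneg_right ?_ (sq_nonneg _)
    have hinj : Function.Injective fun i => (f i : ℕ) := Fin.val_injective.comp hf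
    have := prod_le_prod_range_of_antitone hσ h0 (Finset.univ.image fun i => (f i : ℕ))
    rw [Finset.card_image_of_injective _ hinj, Finset.prod_image hinj.injOn] at this
    simpa using this
  · obtain ⟨i, j, hij, hne⟩ := Function.not_injective_iff.1 hf
    have : (V.submatrix f id).det = 0 :=
      Matrix.det_zero_of_row_eq hne (by ext k; simp [hij])
    simp [this]

/-- An orthonormal basis of right singular vectors. -/
theorem exists_orthonormalBasis_inner_map {n : ℕ} (A : E n →ₗ[ℝ] E n) :
    ∃ b : OrthonormalBasis (Fin n) ℝ (E n), ∀ j x,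
      inner ℝ (A (b j)) (A x) = A.singularValues j ^ 2 * inner ℝ (b j) x := by
  have hn : Module.finrank ℝ (E n) = n := by simp
  refine ⟨A.isSymmetric_adjoint_comp_self.eigenvectorBasis hn, fun j x => ?_⟩
  rw [← LinearMap.adjoint_inner_left, ← LinearMap.comp_apply,
    LinearMap.IsSymmetric.apply_eigenvectorBasis, A.sq_singularValues_fin hn, inner_smul_left]
  simp

/-- Gram determinants are squared volumes. In coordinates along right singular vectors the two Gram
matrices become `VᵀDV` and `VᵀV`. -/
theorem det_gram_map_le {m n : ℕ} (A : E n →ₗ[ℝ] E n) (v : Fin m → E n) :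
    (Matrix.gram ℝ fun i => A (v i)).det ≤
      (∏ i ∈ Finset.range m, A.singularValues i) ^ 2 * (Matrix.gram ℝ v).det := by
  obtain ⟨b, hb⟩ := exists_orthonormalBasis_inner_map A
  set V : Matrix (Fin n) (Fin m) ℝ := Matrix.of fun k i => inner ℝ (b k) (v i) with hV
  have h1 : (Matrix.gram ℝ fun i => A (v i)) =
      V.transpose * Matrix.diagonal (fun k : Fin n => A.singularValues k ^ 2) * V := by
    ext i j
    rw [Matrix.gram_apply, Matrix.mul_apply]
    nth_rewrite 1 [← b.sum_repr' (v i)]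
    simp only [map_sum, map_smul, sum_inner, inner_smul_left, hb, Matrix.mul_diagonal,
      Matrix.transpose_apply, hV, Matrix.of_apply, conj_trivial, mul_assoc]
  have h2 : Matrix.gram ℝ v = V.transpose * V := by
    ext i j
    rw [Matrix.gram_apply, Matrix.mul_apply, ← b.sum_inner_mul_inner]
    exact Finset.sum_congr rfl fun k _ => by
      rw [Matrix.transpose_apply, hV, Matrix.of_apply, Matrix.of_apply, real_inner_comm]
  rw [h1, h2, ← Finset.prod_pow]
  refine det_transpose_diagonal_mul_le V (σ := fun k => A.singularValues k ^ 2) ?_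
    fun i => sq_nonneg _
  exact fun i j h => pow_le_pow_left₀ (A.singularValues_nonneg _) (A.singularValues_antitone h) 2

/-- The product of the first `m` singular values is submultiplicative. -/
theorem prod_singularValues_comp_le {m n : ℕ} (hm : m ≤ n) (A B : E n →ₗ[ℝ] E n) :
    ∏ i ∈ Finset.range m, (A ∘ₗ B).singularValues i ≤
      (∏ i ∈ Finset.range m, A.singularValues i) * ∏ i ∈ Finset.range m, B.singularValues i := by
  obtain ⟨b, hb⟩ := exists_orthonormalBasis_inner_map (A ∘ₗ B)
  -- The first `m` right singular vectors of the composite span unit volume, and their images span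
  -- exactly the product on the left; the volume bound is applied to `B` and then to `A`.
  set v : Fin m → E n := fun i => b (Fin.castLE hm i)
  have hinj := Fin.castLE_injective hm
  have hv : Matrix.gram ℝ v = 1 := by
    ext i j
    simp [Matrix.gram_apply, v, Matrix.one_apply, b.inner_eq_ite, hinj.eq_iff]
  have hAB : Matrix.gram ℝ (fun i => A (B (v i))) =
      Matrix.diagonal fun i : Fin m => (A ∘ₗ B).singularValues i ^ 2 := by
    ext i j
    have := hb (Fin.castLE hm i) (v j)
    simp only [LinearMap.comp_apply] at this
    simp [Matrix.gram_apply, v, this, Matrix.diagonal_apply, b.inner_eq_ite, hinj.eq_iff]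
  have h1 := det_gram_map_le A fun i => B (v i)
  have h2 := det_gram_map_le B v
  rw [hAB, Matrix.det_diagonal,
    Fin.prod_univ_eq_prod_range (fun i => (A ∘ₗ B).singularValues i ^ 2) m,
    Finset.prod_pow] at h1
  rw [hv, Matrix.det_one, mul_one] at h2
  refine le_of_sq_le_sq ?_ (mul_nonneg (Finset.prod_nonneg fun i _ => A.singularValues_nonneg i)
    (Finset.prod_nonneg fun i _ => B.singularValues_nonneg i))
  rw [mul_pow]
  exact h1.trans (mul_le_mul_of_nonneg_left h2 (sq_nonneg _))

theorem norm_map_singular_vector {n : ℕ} {A : E n →ₗ[ℝ] E n}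
    {b : OrthonormalBasis (Fin n) ℝ (E n)}
    (hb : ∀ j x, inner ℝ (A (b j)) (A x) = A.singularValues j ^ 2 * inner ℝ (b j) x) (j : Fin n) :
    ‖A (b j)‖ = A.singularValues j := by
  have h := hb j (b j)
  rw [real_inner_self_eq_norm_sq, real_inner_self_eq_norm_sq, b.norm_eq_one] at h
  exact (sq_eq_sq₀ (norm_nonneg _) (A.singularValues_nonneg _)).1 (by simpa using h)

theorem singularValues_le_of_norm_map_le {n : ℕ} {A : E n →ₗ[ℝ] E n} {c : ℝ}
    (h : ∀ x, ‖A x‖ ≤ c * ‖x‖) {j : ℕ} (hj : j < n) : A.singularValues j ≤ c := by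
  obtain ⟨b, hb⟩ := exists_orthonormalBasis_inner_map A
  have := h (b ⟨j, hj⟩)
  rwa [norm_map_singular_vector hb, b.norm_eq_one, mul_one] at this

theorem singularValues_pos {n : ℕ} (A : E n ≃ₗ[ℝ] E n) {j : ℕ} (hj : j < n) :
    0 < (A : E n →ₗ[ℝ] E n).singularValues j :=
  (A : E n →ₗ[ℝ] E n).injective_iff_forall_lt_finrank_singularValues_pos.1 A.injective j
    (by simpa using hj)

/-- The singular values are submultiplicative under right composition up to a constant depending
only on the right factor. -/
theorem exists_mul_singularValues_le {n : ℕ} (B : E n ≃ₗ[ℝ] E n) {j : ℕ} (hj : j < n) :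
    ∃ a : ℝ, 0 < a ∧ ∀ A : E n ≃ₗ[ℝ] E n,
      a * (A : E n →ₗ[ℝ] E n).singularValues j ≤
        ((A : E n →ₗ[ℝ] E n) ∘ₗ (B : E n →ₗ[ℝ] E n)).singularValues j := by
  have hp : ∀ (A : E n ≃ₗ[ℝ] E n) m, m ≤ n →
      0 < ∏ i ∈ Finset.range m, (A : E n →ₗ[ℝ] E n).singularValues i := fun A m hm =>
    Finset.prod_pos fun i hi => singularValues_pos A ((Finset.mem_range.1 hi).trans_le hm)
  set x := ∏ i ∈ Finset.range (j + 1), (B.symm : E n →ₗ[ℝ] E n).singularValues i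
  set y := ∏ i ∈ Finset.range j, (B : E n →ₗ[ℝ] E n).singularValues i
  have hx : 0 < x := hp _ _ hj
  have hy : 0 < y := hp _ _ hj.le
  -- With `P_j` the product of the first `j` singular values, `A = (AB)B⁻¹` gives `P_{j+1}(A) ≤
  -- P_{j+1}(AB) x`, while `P_j(AB) ≤ P_j(A) y`; then `P_j(A)` cancels.
  refine ⟨(x * y)⁻¹, by positivity, fun A => ?_⟩
  have h1 := prod_singularValues_comp_le (m := j + 1) hj
    ((A : E n →ₗ[ℝ] E n) ∘ₗ (B : E n →ₗ[ℝ] E n)) (B.symm : E n →ₗ[ℝ] E n)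
  have h2 := prod_singularValues_comp_le hj.le (A : E n →ₗ[ℝ] E n) (B : E n →ₗ[ℝ] E n)
  have e : ((A : E n →ₗ[ℝ] E n) ∘ₗ (B : E n →ₗ[ℝ] E n)) ∘ₗ (B.symm : E n →ₗ[ℝ] E n) = A := by
    ext v; simp
  rw [e, Finset.prod_range_succ, Finset.prod_range_succ] at h1
  have hA := hp A j hj.le
  set s := ((A : E n →ₗ[ℝ] E n) ∘ₗ (B : E n →ₗ[ℝ] E n)).singularValues j
  have hs : 0 ≤ s := LinearMap.singularValues_nonneg _ _
  rw [inv_mul_le_iff₀ (by positivity)]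
  refine le_of_mul_le_mul_left ?_ hA
  calc _ ≤ _ := h1
    _ ≤ _ := mul_le_mul_of_nonneg_right (mul_le_mul_of_nonneg_right h2 hs) hx.le
    _ = _ := by ring

/-! ### The singular value function -/

/-- The exponent of the `j`-th singular value in `φ^t`. -/
noncomputable def svExp (n : ℕ) (t : ℝ) (j : ℕ) : ℝ :=
  max 0 (min 1 (t - j)) + max 0 ((t - n) / n)

theorem svExp_mono {n : ℕ} {t t' : ℝ} (h : t ≤ t') (j : ℕ) : svExp n t j ≤ svExp n t' j := by
  unfold svExp
  gcongr

theorem continuous_svExp (n j : ℕ) : Continuous fun t => svExp n t j := by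
  unfold svExp
  fun_prop

theorem sum_svExp {n : ℕ} (hn : 1 ≤ n) {t : ℝ} (ht : 0 ≤ t) :
    ∑ j ∈ Finset.range n, svExp n t j = t := by
  have h1 : ∀ k : ℕ, ∑ j ∈ Finset.range k, max 0 (min 1 (t - j)) = min t k := by
    intro k
    induction k with
    | zero => simp [ht]
    | succ k ih =>
      rw [Finset.sum_range_succ, ih]
      push_cast
      rcases le_total t k with h | h
      · rw [min_eq_left h, min_eq_left (by linarith : t ≤ k + 1),
          min_eq_right (by linarith : t - k ≤ 1), max_eq_left (by linarith), add_zero]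
      · rw [min_eq_right h]
        rcases le_total t (k + 1) with h' | h'
        · rw [min_eq_left h', min_eq_right (by linarith : t - k ≤ 1), max_eq_right (by linarith)]
          ring
        · rw [min_eq_right h', min_eq_left (by linarith : (1 : ℝ) ≤ t - k),
            max_eq_right zero_le_one]
  have hn' : (0 : ℝ) < n := by exact_mod_cast hn
  simp only [svExp, Finset.sum_add_distrib, h1, Finset.sum_const, Finset.card_range, nsmul_eq_mul]
  rcases le_total t n with h | h
  · rw [min_eq_left h, max_eq_left (div_nonpos_of_nonpos_of_nonneg (by linarith) hn'.le)]
    simp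
  · rw [min_eq_right h, max_eq_right (div_nonneg (by linarith) hn'.le)]
    field_simp
    ring

/-- One formula for all three cases lets positivity, continuity and decay in `t` be checked factor
by factor. -/
theorem svf_eq_prod_rpow {n : ℕ} (hn : 1 ≤ n) (t : ℝ) (A : E n →ₗ[ℝ] E n) :
    svf t A = ∏ j ∈ Finset.range n, A.singularValues j ^ svExp n t j := by
  have hn' : (0 : ℝ) < n := by exact_mod_cast hn
  unfold svf
  split_ifs with h0 h1
  · symm
    refine Finset.prod_eq_one fun j _ => ?_
    have e : svExp n t j = 0 := by
      have : (0 : ℝ) ≤ j := j.cast_nonneg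
      rw [svExp, max_eq_left ((min_le_right _ _).trans (by linarith)),
        max_eq_left (div_nonpos_of_nonpos_of_nonneg (by linarith) hn'.le), add_zero]
    rw [e, Real.rpow_zero]
  · push Not at h0
    have hx : max 0 ((t - n) / n) = 0 :=
      max_eq_left (div_nonpos_of_nonpos_of_nonneg (by linarith) hn'.le)
    have hm : 0 < ⌈t⌉₊ := Nat.ceil_pos.2 h0
    have hmn : ⌈t⌉₊ ≤ n := Nat.ceil_le.2 h1
    have hlt : ((⌈t⌉₊ - 1 : ℕ) : ℝ) < t := Nat.lt_ceil.1 (by omega)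
    have hle : t ≤ ⌈t⌉₊ := Nat.le_ceil t
    have hc : ((⌈t⌉₊ - 1 : ℕ) : ℝ) = ⌈t⌉₊ - 1 := by rw [Nat.cast_sub hm, Nat.cast_one]
    rw [← Finset.prod_subset (Finset.range_mono hmn)]
    · obtain ⟨m, hm'⟩ : ∃ m, ⌈t⌉₊ = m + 1 := ⟨⌈t⌉₊ - 1, by omega⟩
      rw [hm'] at hlt hle hc ⊢
      simp only [Nat.add_sub_cancel] at hlt hc ⊢
      push_cast at hle hc ⊢
      rw [Finset.prod_range_succ]
      congr 1
      · refine Finset.prod_congr rfl fun j hj => ?_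
        have hj' : (j : ℝ) + 1 ≤ m := by exact_mod_cast Finset.mem_range.1 hj
        rw [svExp, hx, min_eq_left (by linarith), max_eq_right zero_le_one, add_zero,
          Real.rpow_one]
      · rw [svExp, hx, min_eq_right (by linarith), max_eq_right (by linarith)]
        congr 1
        ring
    · intro j _ hj
      have hj' : (⌈t⌉₊ : ℝ) ≤ j := by exact_mod_cast not_lt.1 (fun h => hj (Finset.mem_range.2 h))
      rw [svExp, hx, max_eq_left ((min_le_right _ _).trans (by linarith)), add_zero,
        Real.rpow_zero]
  · push Not at h1
    rw [← LinearMap.normDet_eq_abs_det, LinearMap.normDet_eq_prod_singularValues,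
      ← Real.finsetProd_rpow _ _ fun i _ => A.singularValues_nonneg i]
    simp only [finrank_euclideanSpace, Fintype.card_fin]
    refine Finset.prod_congr rfl fun j hj => ?_
    have hj' : (j : ℝ) + 1 ≤ n := by exact_mod_cast Finset.mem_range.1 hj
    rw [svExp, min_eq_left (by linarith), max_eq_right zero_le_one,
      max_eq_right (div_nonneg (by linarith) hn'.le)]
    congr 1
    field_simp
    ring

theorem svf_pos {n : ℕ} (hn : 1 ≤ n) (t : ℝ) (A : E n ≃ₗ[ℝ] E n) :
    0 < svf t (A : E n →ₗ[ℝ] E n) := by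
  rw [svf_eq_prod_rpow hn]
  exact Finset.prod_pos fun j hj => Real.rpow_pos_of_pos
    (singularValues_pos A (Finset.mem_range.1 hj)) _

theorem continuous_svf {n : ℕ} (hn : 1 ≤ n) (A : E n ≃ₗ[ℝ] E n) :
    Continuous fun t => svf t (A : E n →ₗ[ℝ] E n) := by
  simp only [svf_eq_prod_rpow hn]
  refine continuous_finsetProd _ fun j hj => ?_
  exact continuous_const.rpow (continuous_svExp n j)
    fun _ => Or.inl (singularValues_pos A (Finset.mem_range.1 hj)).ne'

/-- Every exponent grows with `t`, the growths add up to `t' - t` by `sum_svExp`, and each singular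
value is at most `c`. -/
theorem svf_le_rpow_mul {n : ℕ} (hn : 1 ≤ n) {t t' c : ℝ} (ht : 0 ≤ t) (htt : t ≤ t')
    (hc : 0 < c) (A : E n ≃ₗ[ℝ] E n) (hA : ∀ x, ‖A x‖ ≤ c * ‖x‖) :
    svf t' (A : E n →ₗ[ℝ] E n) ≤ c ^ (t' - t) * svf t (A : E n →ₗ[ℝ] E n) := by
  have hexps : t' - t = ∑ j ∈ Finset.range n, (svExp n t' j - svExp n t j) := by
    rw [Finset.sum_sub_distrib, sum_svExp hn ht, sum_svExp hn (ht.trans htt)]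
  rw [svf_eq_prod_rpow hn, svf_eq_prod_rpow hn, hexps, Real.rpow_sum_of_pos hc,
    ← Finset.prod_mul_distrib]
  refine Finset.prod_le_prod (fun j _ => Real.rpow_nonneg (LinearMap.singularValues_nonneg _ _) _)
    fun j hj => ?_
  have hpos := singularValues_pos A (Finset.mem_range.1 hj)
  have hle : (A : E n →ₗ[ℝ] E n).singularValues j ≤ c :=
    singularValues_le_of_norm_map_le hA (Finset.mem_range.1 hj)
  have hexp := svExp_mono (n := n) htt j
  calc (A : E n →ₗ[ℝ] E n).singularValues j ^ svExp n t' j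
      = (A : E n →ₗ[ℝ] E n).singularValues j ^ (svExp n t' j - svExp n t j) *
          (A : E n →ₗ[ℝ] E n).singularValues j ^ svExp n t j := by
        rw [← Real.rpow_add hpos, sub_add_cancel]
    _ ≤ _ := mul_le_mul_of_nonneg_right (Real.rpow_le_rpow hpos.le hle (by linarith))
        (Real.rpow_nonneg hpos.le _)

/-- For `0 < t ≤ n`, `φ^t` is the weighted geometric mean `P_{m-1} ^ (1-θ) * P_m ^ θ` of two
submultiplicative products of singular values; beyond `n` it is a power of the determinant. -/
theorem svf_comp_le {n : ℕ} (t : ℝ) (A B : E n →ₗ[ℝ] E n) :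
    svf t (A ∘ₗ B) ≤ svf t A * svf t B := by
  by_cases h0 : t ≤ 0
  · simp [svf, h0]
  by_cases h1 : t ≤ n
  · push Not at h0
    have hm : 0 < ⌈t⌉₊ := Nat.ceil_pos.2 h0
    have hmn : ⌈t⌉₊ ≤ n := Nat.ceil_le.2 h1
    have hlt : ((⌈t⌉₊ - 1 : ℕ) : ℝ) < t := Nat.lt_ceil.1 (by omega)
    have hle : t ≤ ⌈t⌉₊ := Nat.le_ceil t
    rw [Nat.cast_sub hm, Nat.cast_one] at hlt
    set θ := t - (⌈t⌉₊ : ℝ) + 1 with hθ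
    have key : ∀ T : E n →ₗ[ℝ] E n, svf t T =
        (∏ i ∈ Finset.range (⌈t⌉₊ - 1), T.singularValues i) ^ (1 - θ) *
          (∏ i ∈ Finset.range (⌈t⌉₊ - 1 + 1), T.singularValues i) ^ θ := by
      intro T
      have hp : 0 ≤ ∏ i ∈ Finset.range (⌈t⌉₊ - 1), T.singularValues i :=
        Finset.prod_nonneg fun i _ => T.singularValues_nonneg i
      rw [Finset.prod_range_succ, Real.mul_rpow hp (T.singularValues_nonneg _), ← mul_assoc,
        ← Real.rpow_add_of_nonneg hp (by linarith) (by linarith), sub_add_cancel, Real.rpow_one,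
        svf, if_neg (not_le.2 h0), if_pos h1]
    have hp : ∀ (T : E n →ₗ[ℝ] E n) m, 0 ≤ ∏ i ∈ Finset.range m, T.singularValues i :=
      fun T m => Finset.prod_nonneg fun i _ => T.singularValues_nonneg i
    rw [key, key A, key B, mul_mul_mul_comm, ← Real.mul_rpow (hp _ _) (hp _ _),
      ← Real.mul_rpow (hp _ _) (hp _ _)]
    exact mul_le_mul
      (Real.rpow_le_rpow (hp _ _) (prod_singularValues_comp_le (by omega) A B) (by linarith))
      (Real.rpow_le_rpow (hp _ _) (prod_singularValues_comp_le (by omega) A B) (by linarith))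
      (Real.rpow_nonneg (hp _ _) _)
      (Real.rpow_nonneg (mul_nonneg (hp _ _) (hp _ _)) _)
  · simp only [svf, if_neg h0, if_neg h1]
    rw [LinearMap.det_comp, abs_mul, Real.mul_rpow (abs_nonneg _) (abs_nonneg _)]

/-! ### Sums over words -/

section Words

variable {n N : ℕ} (S : Fin N → (E n ≃ᵃ[ℝ] E n))

theorem wordMap_append {j k : ℕ} (u : Fin j → Fin N) (v : Fin k → Fin N) :
    wordMap S (Fin.append u v) = wordMap S u * wordMap S v := by
  have h : (fun i => S (Fin.append u v i)) = Fin.append (fun i => S (u i)) (fun i => S (v i)) := by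
    ext i : 1
    refine Fin.addCases (fun i => ?_) (fun i => ?_) i <;> simp
  rw [wordMap, h, List.ofFn_fin_append, List.prod_append]
  rfl

theorem wordMap_snoc {k : ℕ} (w : Fin k → Fin N) (i : Fin N) :
    wordMap S (Fin.snoc w i : Fin (k + 1) → Fin N) = wordMap S w * S i := by
  rw [wordMap, List.ofFn_succ']
  simp [wordMap]

theorem linear_mul_toLinearMap (e e' : E n ≃ᵃ[ℝ] E n) :
    ((e * e').linear : E n →ₗ[ℝ] E n) = (e.linear : E n →ₗ[ℝ] E n) ∘ₗ (e'.linear : E n →ₗ[ℝ] E n) :=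
  rfl

theorem svfSum_pos (hn : 1 ≤ n) (hN : 0 < N) (k : ℕ) (t : ℝ) : 0 < svfSum S k t :=
  Finset.sum_pos (fun _ _ => svf_pos hn t _) ⟨fun _ => ⟨0, hN⟩, Finset.mem_univ _⟩

theorem svfSum_nonneg (hn : 1 ≤ n) (k : ℕ) (t : ℝ) : 0 ≤ svfSum S k t :=
  Finset.sum_nonneg fun _ _ => (svf_pos hn t _).le

theorem svfSum_add_le (j k : ℕ) (t : ℝ) :
    svfSum S (j + k) t ≤ svfSum S j t * svfSum S k t := by
  unfold svfSum
  rw [← Equiv.sum_comp (Fin.appendEquiv j k), Fintype.sum_prod_type, Finset.sum_mul_sum]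
  refine Finset.sum_le_sum fun u _ => Finset.sum_le_sum fun v _ => ?_
  change svf t ((wordMap S (Fin.append u v)).linear : E n →ₗ[ℝ] E n) ≤ _
  rw [wordMap_append, linear_mul_toLinearMap]
  exact svf_comp_le _ _ _

/-- With `q < 1` the sum at level `j`, the partial sums satisfy `T L ≤ T (j + L) ≤ T j + q * T L`,
so they are bounded. -/
theorem summable_svfSum (hn : 1 ≤ n) {j : ℕ} {t : ℝ} (h : svfSum S j t < 1) :
    Summable fun k => svfSum S k t := by
  set T : ℕ → ℝ := fun L => ∑ k ∈ Finset.range L, svfSum S k t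
  refine summable_of_sum_range_le (c := T j / (1 - svfSum S j t))
    (fun k => svfSum_nonneg S hn k t) fun L => ?_
  rw [le_div_iff₀ (by linarith)]
  have h1 : T L ≤ T (j + L) := Finset.sum_le_sum_of_subset_of_nonneg
    (Finset.range_mono (by omega)) fun k _ _ => svfSum_nonneg S hn k t
  have h2 : T (j + L) ≤ T j + svfSum S j t * T L := by
    simp only [T, Finset.sum_range_add, Finset.mul_sum]
    gcongr
    exact svfSum_add_le S j _ t
  change T L * _ ≤ _
  linarith

variable {S}

theorem IsContracting.exists_norm_linear_le {T : E n ≃ᵃ[ℝ] E n} (h : IsContracting T) :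
    ∃ c : ℝ, 0 < c ∧ c < 1 ∧ ∀ x, ‖T.linear x‖ ≤ c * ‖x‖ := by
  obtain ⟨c, h0, h1, h⟩ := h
  refine ⟨c, h0, h1, fun x => ?_⟩
  have h2 := h (x +ᵥ (0 : E n)) 0
  rw [T.map_vadd] at h2
  simpa [dist_eq_norm] using h2

theorem IsAffineIFS.exists_norm_linear_le (hS : IsAffineIFS S) :
    ∃ c : ℝ, 0 < c ∧ c < 1 ∧ ∀ i x, ‖(S i).linear x‖ ≤ c * ‖x‖ := by
  choose c h0 h1 h using fun i => (hS.2 i).exists_norm_linear_le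
  have : Nonempty (Fin N) := ⟨⟨0, hS.1⟩⟩
  obtain ⟨i₀, hi₀⟩ := Finite.exists_max c
  exact ⟨c i₀, h0 _, h1 _, fun i x =>
    (h i x).trans (mul_le_mul_of_nonneg_right (hi₀ i) (norm_nonneg _))⟩

theorem norm_wordMap_linear_le {c : ℝ} (hc : 0 ≤ c) (h : ∀ i x, ‖(S i).linear x‖ ≤ c * ‖x‖)
    {k : ℕ} (w : Fin k → Fin N) (x : E n) : ‖(wordMap S w).linear x‖ ≤ c ^ k * ‖x‖ := by
  induction k generalizing x with
  | zero =>
    rw [pow_zero, one_mul]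
    exact le_rfl
  | succ k ih =>
    have e : wordMap S w = wordMap S (Fin.init w) * S (w (Fin.last k)) := by
      rw [← wordMap_snoc, Fin.snoc_init_self]
    rw [e]
    calc ‖(wordMap S (Fin.init w)).linear ((S (w (Fin.last k))).linear x)‖
        ≤ c ^ k * (c * ‖x‖) := (ih _ _).trans (by gcongr; exact h _ _)
      _ = _ := by ring

theorem svfSum_le_rpow_mul (hn : 1 ≤ n) {c : ℝ} (hc : 0 < c)
    (h : ∀ i x, ‖(S i).linear x‖ ≤ c * ‖x‖) (k : ℕ) {t t' : ℝ} (ht : 0 ≤ t) (htt : t ≤ t') :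
    svfSum S k t' ≤ (c ^ k) ^ (t' - t) * svfSum S k t := by
  unfold svfSum
  rw [Finset.mul_sum]
  exact Finset.sum_le_sum fun w _ => svf_le_rpow_mul hn ht htt (by positivity) _
    (norm_wordMap_linear_le hc.le h w)

theorem svfSum_lt_of_lt (hn : 1 ≤ n) (hS : IsAffineIFS S) {k : ℕ} (hk : 1 ≤ k) {t t' : ℝ}
    (ht : 0 ≤ t) (htt : t < t') : svfSum S k t' < svfSum S k t := by
  obtain ⟨c, h0, h1, hc⟩ := hS.exists_norm_linear_le
  refine (svfSum_le_rpow_mul hn h0 hc k ht htt.le).trans_lt ?_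
  exact mul_lt_of_lt_one_left (svfSum_pos S hn hS.1 k t)
    (Real.rpow_lt_one (by positivity) (pow_lt_one₀ h0.le h1 (by omega)) (by linarith))

theorem svfSum_zero_right (k : ℕ) : svfSum S k 0 = (N : ℝ) ^ k := by
  simp [svfSum, svf]

theorem continuous_svfSum (hn : 1 ≤ n) (k : ℕ) : Continuous (svfSum S k) :=
  continuous_finsetSum _ fun _ _ => continuous_svf hn _

theorem exists_svfSum_eq_one (hn : 1 ≤ n) (hS : IsAffineIFS S) {k : ℕ} (hk : 1 ≤ k) :
    ∃ t, 0 ≤ t ∧ svfSum S k t = 1 := by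
  obtain ⟨c, h0, h1, hc⟩ := hS.exists_norm_linear_le
  have hN : (1 : ℝ) ≤ N := by exact_mod_cast hS.1
  have hN' : (1 : ℝ) ≤ (N : ℝ) ^ k := one_le_pow₀ hN
  have hlim : Tendsto (fun t : ℝ => (c ^ k) ^ t * (N : ℝ) ^ k) atTop (𝓝 0) := by
    have hck : 0 < c ^ k := by positivity
    simpa using (tendsto_rpow_atTop_of_base_lt_one (c ^ k) (by linarith)
      (pow_lt_one₀ h0.le h1 (by omega))).mul_const ((N : ℝ) ^ k)
  obtain ⟨T, hT1, hT0⟩ := ((hlim.eventually_lt_const one_pos).and (eventually_ge_atTop 0)).exists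
  have h2 : svfSum S k T ≤ 1 := by
    have := svfSum_le_rpow_mul hn h0 hc k le_rfl hT0
    rw [svfSum_zero_right, sub_zero] at this
    exact this.trans hT1.le
  obtain ⟨t, ht, h⟩ := intermediate_value_Icc' hT0 (continuous_svfSum (S := S) hn k).continuousOn
    ⟨h2, by rwa [svfSum_zero_right]⟩
  exact ⟨t, ht.1, h⟩

theorem lt_of_svfSum_lt_one (hn : 1 ≤ n) (hS : IsAffineIFS S) {k : ℕ} (hk : 1 ≤ k) {s t : ℝ}
    (ht : 0 ≤ t) (hs : svfSum S k s = 1) (h : svfSum S k t < 1) : s < t := by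
  by_contra! hst
  rcases hst.eq_or_lt with rfl | hlt
  · exact h.ne hs
  · have := svfSum_lt_of_lt hn hS hk ht hlt
    linarith

/-- The limit is the infimum of the `σ k`: if `b > σ j`, the level-`j` sum at `b` is below one, so
the level sums at `b` tend to zero and eventually `σ k < b`. -/
theorem existsUnique_isAffinityDim (hn : 1 ≤ n) (hS : IsAffineIFS S) :
    ∃! s : ℝ, IsAffinityDim S s := by
  have hex : ∀ k : ℕ, ∃ t, 1 ≤ k → 0 ≤ t ∧ svfSum S k t = 1 := fun k => by
    by_cases hk : 1 ≤ k
    · obtain ⟨t, ht⟩ := exists_svfSum_eq_one hn hS hk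
      exact ⟨t, fun _ => ht⟩
    -- The value at level zero is arbitrary, which is why the infimum below runs over `Ici 1`.
    · exact ⟨0, fun h => absurd h hk⟩
  choose σ hσ using hex
  have hbdd : BddBelow (σ '' Ici 1) := ⟨0, by rintro _ ⟨k, hk, rfl⟩; exact (hσ k hk).1⟩
  have hne : (σ '' Ici 1).Nonempty := ⟨σ 1, 1, mem_Ici.2 le_rfl, rfl⟩
  have hσlim : Tendsto σ atTop (𝓝 (sInf (σ '' Ici 1))) := by
    refine tendsto_order.2 ⟨fun a ha => ?_, fun b hb => ?_⟩
    · filter_upwards [eventually_ge_atTop 1] with k hk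
      exact ha.trans_le (csInf_le hbdd ⟨k, hk, rfl⟩)
    · obtain ⟨_, ⟨j, hj, rfl⟩, hjb⟩ := exists_lt_of_csInf_lt hne hb
      have h1 : svfSum S j b < 1 :=
        (svfSum_lt_of_lt hn hS hj (hσ j hj).1 hjb).trans_eq (hσ j hj).2
      have h2 := (summable_svfSum S hn h1).tendsto_atTop_zero
      filter_upwards [eventually_ge_atTop 1, h2.eventually_lt_const one_pos] with k hk hk'
      exact lt_of_svfSum_lt_one hn hS hk ((hσ j hj).1.trans hjb.le) (hσ k hk).2 hk'
  refine ⟨_, ⟨σ, hσ, hσlim⟩, fun s ⟨τ, hτ, hlim⟩ => tendsto_nhds_unique (hlim.congr' ?_) hσlim⟩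
  filter_upwards [eventually_ge_atTop 1] with k hk
  rcases lt_trichotomy (τ k) (σ k) with h | h | h
  · have := svfSum_lt_of_lt hn hS hk (hτ k hk).1 h
    linarith [(hσ k hk).2, (hτ k hk).2]
  · exact h
  · have := svfSum_lt_of_lt hn hS hk (hσ k hk).1 h
    linarith [(hσ k hk).2, (hτ k hk).2]

theorem IsAffinityDim.nonneg {s : ℝ} (hs : IsAffinityDim S s) : 0 ≤ s := by
  obtain ⟨σ, hσ, hlim⟩ := hs
  exact ge_of_tendsto hlim ((eventually_ge_atTop 1).mono fun k hk => (hσ k hk).1)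

/-- Besides `0 ≤ s`, this is all that the dimension bound needs to know about `s`. -/
theorem IsAffinityDim.summable_svfSum {s t : ℝ} (hn : 1 ≤ n) (hS : IsAffineIFS S)
    (hs : IsAffinityDim S s) (ht : s < t) : Summable fun k => svfSum S k t := by
  obtain ⟨σ, hσ, hlim⟩ := hs
  obtain ⟨k, hk, hkt⟩ := ((eventually_ge_atTop 1).and (hlim.eventually_lt_const ht)).exists
  exact InhomSelfAffine.summable_svfSum S hn (j := k)
    ((svfSum_lt_of_lt hn hS hk (hσ k hk).1 hkt).trans_eq (hσ k hk).2)

end Words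

/-! ### Box counting -/

theorem boxCount_le_card {n : ℕ} {δ : ℝ} {F : Set (E n)} {ι : Type*} [Fintype ι]
    {Q : ι → Set (E n)} (hQ : ∀ i, IsHypercube δ (Q i)) (hF : F ⊆ ⋃ i, Q i) :
    boxCount δ F ≤ Fintype.card ι := by
  refine Nat.sInf_le ⟨fun i => Q ((Fintype.equivFin ι).symm i), fun i => hQ _, ?_⟩
  rwa [(Fintype.equivFin ι).symm.surjective.iUnion_comp]

/-- Hypercubes may have any orientation, so a grid along the axes of the orthotope, starting at its
lowest corner, is allowed. -/
theorem exists_cover_orthotope {n : ℕ} {δ : ℝ} (hδ : 0 < δ) (b : OrthonormalBasis (Fin n) ℝ (E n))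
    (y₀ : E n) (l : Fin n → ℝ) :
    ∃ Q : (∀ j, Fin (⌊2 * l j / δ⌋₊ + 1)) → Set (E n), (∀ k, IsHypercube δ (Q k)) ∧
      {y | ∀ j, |inner ℝ (b j) (y - y₀)| ≤ l j} ⊆ ⋃ k, Q k := by
  refine ⟨fun k => {x | ∀ j, inner ℝ (b j)
    (x - (y₀ + ∑ i, (-l i + (k i : ℕ) * δ) • b i)) ∈ Icc (0 : ℝ) δ}, fun k => ⟨_, b, rfl⟩, ?_⟩
  intro y hy
  have hy0 : ∀ j, 0 ≤ inner ℝ (b j) (y - y₀) + l j := fun j => by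
    linarith [(abs_le.1 (hy j)).1]
  have hy1 : ∀ j, inner ℝ (b j) (y - y₀) + l j ≤ 2 * l j := fun j => by
    linarith [(abs_le.1 (hy j)).2]
  refine mem_iUnion.2 ⟨fun j => ⟨⌊(inner ℝ (b j) (y - y₀) + l j) / δ⌋₊,
    Nat.lt_succ_of_le (Nat.floor_le_floor (div_le_div_of_nonneg_right (hy1 j) hδ.le))⟩,
    fun j => ?_⟩
  have h1 := Nat.floor_le (div_nonneg (hy0 j) hδ.le)
  have h2 := Nat.lt_floor_add_one ((inner ℝ (b j) (y - y₀) + l j) / δ)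
  rw [le_div_iff₀ hδ] at h1
  rw [div_lt_iff₀ hδ] at h2
  rw [← sub_sub, inner_sub_right _ _ (∑ i, _), inner_sum]
  simp only [inner_smul_right, b.inner_eq_ite, mul_ite, mul_one, mul_zero, Finset.sum_ite_eq,
    Finset.mem_univ, if_true]
  constructor <;> linarith

theorem boxCount_orthotope_le {n : ℕ} {δ : ℝ} (hδ : 0 < δ) (b : OrthonormalBasis (Fin n) ℝ (E n))
    (y₀ : E n) {l : Fin n → ℝ} (hl : ∀ j, 0 ≤ l j) {F : Set (E n)}
    (hF : ∀ y ∈ F, ∀ j, |inner ℝ (b j) (y - y₀)| ≤ l j) :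
    (boxCount δ F : ℝ) ≤ ∏ j, (2 * l j / δ + 1) := by
  obtain ⟨Q, hQ, h⟩ := exists_cover_orthotope hδ b y₀ l
  have h1 := boxCount_le_card hQ (Subset.trans hF h)
  rw [Fintype.card_pi] at h1
  calc (boxCount δ F : ℝ) ≤ ∏ j, ((⌊2 * l j / δ⌋₊ : ℝ) + 1) := by
        refine (Nat.cast_le.2 h1).trans_eq ?_
        push_cast [Fintype.card_fin]
        rfl
    _ ≤ _ := Finset.prod_le_prod (fun j _ => by positivity) fun j _ => by
        have := Nat.floor_le (div_nonneg (mul_nonneg zero_le_two (hl j)) hδ.le)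
        linarith

/-- Boundedness makes the set of admissible cardinalities nonempty, so its `sInf` is attained rather
than the default zero. -/
theorem exists_hypercube_cover {n : ℕ} {δ : ℝ} (hδ : 0 < δ) {F : Set (E n)}
    (hF : Bornology.IsBounded F) :
    ∃ Q : Fin (boxCount δ F) → Set (E n), (∀ i, IsHypercube δ (Q i)) ∧ F ⊆ ⋃ i, Q i := by
  obtain ⟨R, hR⟩ := hF.subset_closedBall 0
  obtain ⟨Q, hQ, h⟩ := exists_cover_orthotope hδ (EuclideanSpace.basisFun (Fin n) ℝ) 0 fun _ => R
  refine Nat.sInf_mem (s := {m : ℕ | ∃ Q : Fin m → Set (E n),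
    (∀ i, IsHypercube δ (Q i)) ∧ F ⊆ ⋃ i, Q i})
    ⟨_, fun i => Q ((Fintype.equivFin _).symm i), fun i => hQ _, ?_⟩
  rw [(Fintype.equivFin _).symm.surjective.iUnion_comp]
  refine Subset.trans ?_ h
  intro x hx j
  have h1 := abs_real_inner_le_norm (EuclideanSpace.basisFun (Fin n) ℝ j) (x - 0)
  rw [OrthonormalBasis.norm_eq_one, one_mul, sub_zero] at h1
  rw [sub_zero]
  exact h1.trans (by simpa using hR hx)

theorem boxCount_mono {n : ℕ} {δ : ℝ} (hδ : 0 < δ) {F G : Set (E n)} (h : F ⊆ G)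
    (hG : Bornology.IsBounded G) : boxCount δ F ≤ boxCount δ G := by
  obtain ⟨Q, hQ, hc⟩ := exists_hypercube_cover hδ hG
  simpa using boxCount_le_card hQ (h.trans hc)

theorem boxCount_iUnion_le {n : ℕ} {δ : ℝ} (hδ : 0 < δ) {ι : Type*} [Fintype ι]
    {F : ι → Set (E n)} (hF : ∀ i, Bornology.IsBounded (F i)) :
    boxCount δ (⋃ i, F i) ≤ ∑ i, boxCount δ (F i) := by
  choose Q hQ hc using fun i => exists_hypercube_cover hδ (hF i)
  have := boxCount_le_card (δ := δ) (F := ⋃ i, F i)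
    (Q := fun p : Σ i, Fin (boxCount δ (F i)) => Q p.1 p.2) (fun p => hQ _ _)
    (iUnion_subset fun i => (hc i).trans
      (iUnion_subset fun k => subset_iUnion_of_subset ⟨i, k⟩ Subset.rfl))
  simpa using this

theorem boxCount_anti {n : ℕ} {δ δ' : ℝ} (hδ : 0 < δ) (h : δ ≤ δ') {F : Set (E n)}
    (hF : Bornology.IsBounded F) : boxCount δ' F ≤ boxCount δ F := by
  obtain ⟨Q, hQ, hc⟩ := exists_hypercube_cover hδ hF
  choose p b hQ using hQ
  refine (boxCount_le_card (Q := fun i => {x | ∀ j, inner ℝ (b i j) (x - p i) ∈ Icc (0 : ℝ) δ'})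
    (fun i => ⟨p i, b i, rfl⟩) (hc.trans (iUnion_mono fun i => ?_))).trans_eq (Fintype.card_fin _)
  rw [hQ i]
  exact fun x hx j => ⟨(hx j).1, (hx j).2.trans h⟩

theorem IsHypercube.subset_closedBall {n : ℕ} {δ : ℝ} {Q : Set (E n)} (h : IsHypercube δ Q) :
    ∃ p, Q ⊆ Metric.closedBall p (n * δ) := by
  obtain ⟨p, b, rfl⟩ := h
  refine ⟨p, fun x hx => ?_⟩
  rw [mem_closedBall_iff_norm, ← b.sum_repr' (x - p)]
  refine (norm_sum_le _ _).trans ((Finset.sum_le_sum (g := fun _ => δ) fun j _ => ?_).trans_eq ?_)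
  · rw [norm_smul, b.norm_eq_one, mul_one, Real.norm_eq_abs, abs_of_nonneg (hx j).1]
    exact (hx j).2
  · simp

/-! ### Affine images -/

/-- The image is an ellipsoid with semi-axes `r * α_j` along the left singular vectors, hence inside
the orthotope with these half-sides. -/
theorem boxCount_image_closedBall_le {n : ℕ} {δ : ℝ} (hδ : 0 < δ) (T : E n ≃ᵃ[ℝ] E n) (x : E n)
    {r : ℝ} (hr : 0 ≤ r) :
    (boxCount δ (T '' Metric.closedBall x r) : ℝ) ≤
      ∏ j ∈ Finset.range n, (2 * (r * (T.linear : E n →ₗ[ℝ] E n).singularValues j) / δ + 1) := by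
  set A : E n →ₗ[ℝ] E n := (T.linear : E n →ₗ[ℝ] E n) with hA
  have hpos : ∀ j : Fin n, 0 < A.singularValues j := fun j => singularValues_pos T.linear j.2
  obtain ⟨b, hb⟩ := exists_orthonormalBasis_inner_map A
  have hu : Orthonormal ℝ fun j : Fin n => (A.singularValues j)⁻¹ • A (b j) := by
    rw [orthonormal_iff_ite]
    intro i j
    rw [inner_smul_left, inner_smul_right, hb, b.inner_eq_ite]
    split_ifs with h
    · subst h
      have := (hpos i).ne'
      simp
      field_simp
    · simp
  obtain ⟨u, hu'⟩ := Orthonormal.exists_orthonormalBasis_extension_of_card_eq (𝕜 := ℝ) (E := E n)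
    (ι := Fin n) (by simp) (v := fun j => (A.singularValues j)⁻¹ • A (b j)) (s := univ)
    (hu.comp _ Subtype.val_injective)
  rw [← Fin.prod_univ_eq_prod_range (fun j => 2 * (r * A.singularValues j) / δ + 1) n]
  refine boxCount_orthotope_le hδ u (T x) (fun j => mul_nonneg hr (hpos j).le) ?_
  rintro _ ⟨y, hy, rfl⟩ j
  have hTy : T y - T x = A (y - x) := ((T : E n →ᵃ[ℝ] E n).linearMap_vsub y x).symm
  rw [hu' j (mem_univ _), hTy, inner_smul_left, hb, conj_trivial]
  have h1 := abs_real_inner_le_norm (b j) (y - x)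
  rw [b.norm_eq_one, one_mul] at h1
  have h2 : ‖y - x‖ ≤ r := mem_closedBall_iff_norm.1 hy
  have e : (A.singularValues j)⁻¹ * (A.singularValues j ^ 2 * inner ℝ (b j) (y - x)) =
      inner ℝ (b j) (y - x) * A.singularValues j := by
    have := (hpos j).ne'
    field_simp
  rw [e, abs_mul, abs_of_pos (hpos j)]
  exact mul_le_mul_of_nonneg_right (h1.trans h2) (hpos j).le

/-- Let `m = ⌈t⌉₊ - 1`, indexing from zero. The hypothesis bounds the factors from index `m` on by
`2κ + 1`, and the earlier ones by `(2κ + 1) * α_j / α_m`. The product of these ratios over `j < m`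
is exactly `φ^t / α_m ^ t`. -/
theorem boxCount_image_closedBall_le_svf {n : ℕ} {δ : ℝ} (hδ : 0 < δ) (T : E n ≃ᵃ[ℝ] E n)
    (x : E n) {r κ t : ℝ} (hr : 0 ≤ r) (hκ : 0 ≤ κ) (ht : 0 < t) (htn : t ≤ n)
    (h : r * (T.linear : E n →ₗ[ℝ] E n).singularValues (⌈t⌉₊ - 1) ≤ κ * δ) :
    (boxCount δ (T '' Metric.closedBall x r) : ℝ) ≤
      (2 * κ + 1) ^ n * (svf t (T.linear : E n →ₗ[ℝ] E n) /
        (T.linear : E n →ₗ[ℝ] E n).singularValues (⌈t⌉₊ - 1) ^ t) := by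
  refine (boxCount_image_closedBall_le hδ T x hr).trans ?_
  have hm : 0 < ⌈t⌉₊ := Nat.ceil_pos.2 ht
  have hmn : ⌈t⌉₊ ≤ n := Nat.ceil_le.2 htn
  have hc : ((⌈t⌉₊ - 1 : ℕ) : ℝ) = ⌈t⌉₊ - 1 := by rw [Nat.cast_sub hm, Nat.cast_one]
  set m := ⌈t⌉₊ - 1
  set A : E n →ₗ[ℝ] E n := (T.linear : E n →ₗ[ℝ] E n)
  have hpos : ∀ j, j < n → 0 < A.singularValues j := fun j hj => singularValues_pos T.linear hj
  have hσ := hpos m (by omega)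
  have hsvf : svf t A / A.singularValues m ^ t =
      ∏ j ∈ Finset.range m, A.singularValues j / A.singularValues m := by
    rw [Finset.prod_div_distrib, Finset.prod_const, Finset.card_range, svf, if_neg (not_le.2 ht),
      if_pos htn, show t - (⌈t⌉₊ : ℝ) + 1 = t - m by rw [hc]; ring, Real.rpow_sub hσ,
      Real.rpow_natCast]
    have := Real.rpow_pos_of_pos hσ t
    field_simp
    rfl
  have hle : ∀ j, 2 * (r * A.singularValues j) / δ ≤
      2 * κ * (A.singularValues j / A.singularValues m) := by
    intro j
    rw [div_le_iff₀ hδ]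
    have h0 := A.singularValues_nonneg j
    calc 2 * (r * A.singularValues j)
        = 2 * (r * A.singularValues m) * (A.singularValues j / A.singularValues m) := by
          field_simp
      _ ≤ 2 * (κ * δ) * (A.singularValues j / A.singularValues m) := by gcongr
      _ = _ := by ring
  have hn : n = m + (n - m) := by omega
  have hsplit : ∏ j ∈ Finset.range n, (2 * (r * A.singularValues j) / δ + 1) =
      (∏ j ∈ Finset.range m, (2 * (r * A.singularValues j) / δ + 1)) *
        ∏ j ∈ Finset.range (n - m), (2 * (r * A.singularValues (m + j)) / δ + 1) := by
    rw [← Finset.prod_range_add (fun j => 2 * (r * A.singularValues j) / δ + 1), ← hn]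
  rw [hsvf, hsplit]
  have h1 : ∏ j ∈ Finset.range m, (2 * (r * A.singularValues j) / δ + 1) ≤
      (2 * κ + 1) ^ m * ∏ j ∈ Finset.range m, A.singularValues j / A.singularValues m := by
    have e : (2 * κ + 1) ^ m = ∏ _j ∈ Finset.range m, (2 * κ + 1) := by simp
    rw [e, ← Finset.prod_mul_distrib]
    refine Finset.prod_le_prod (fun j _ => ?_) fun j hj => ?_
    · have := A.singularValues_nonneg j
      positivity
    · have : 1 ≤ A.singularValues j / A.singularValues m := by
        rw [one_le_div hσ]
        exact A.singularValues_antitone (Finset.mem_range.1 hj).le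
      linarith [hle j]
  have h2 : ∏ j ∈ Finset.range (n - m), (2 * (r * A.singularValues (m + j)) / δ + 1) ≤
      (2 * κ + 1) ^ (n - m) := by
    have e : (2 * κ + 1) ^ (n - m) = ∏ _j ∈ Finset.range (n - m), (2 * κ + 1) := by simp
    rw [e]
    refine Finset.prod_le_prod (fun j _ => ?_) fun j _ => ?_
    · have := A.singularValues_nonneg (m + j)
      positivity
    · have h3 : A.singularValues (m + j) / A.singularValues m ≤ 1 := by
        rw [div_le_one hσ]
        exact A.singularValues_antitone (Nat.le_add_right m j)
      have := hle (m + j)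
      have := mul_le_mul_of_nonneg_left h3 (by linarith : 0 ≤ 2 * κ)
      linarith
  have e : (2 * κ + 1) ^ n = (2 * κ + 1) ^ m * (2 * κ + 1) ^ (n - m) := by rw [← pow_add, ← hn]
  rw [e, mul_right_comm]
  refine mul_le_mul h1 h2 (Finset.prod_nonneg fun j _ => ?_) ?_
  · have := A.singularValues_nonneg (m + j)
    positivity
  · exact mul_nonneg (by positivity) (Finset.prod_nonneg fun j _ =>
      div_nonneg (A.singularValues_nonneg j) hσ.le)

/-- Cubes of side `δ / σ` covering `F` sit in balls of radius `n * δ / σ`, whose images have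
critical semi-axis `n * δ`; hence `κ = n`. -/
theorem boxCount_image_le_svf {n : ℕ} {δ : ℝ} (hδ : 0 < δ) (T : E n ≃ᵃ[ℝ] E n)
    {F : Set (E n)} (hF : Bornology.IsBounded F) {t : ℝ} (ht : 0 < t) (htn : t ≤ n) :
    (boxCount δ (T '' F) : ℝ) ≤
      boxCount (δ / (T.linear : E n →ₗ[ℝ] E n).singularValues (⌈t⌉₊ - 1)) F *
      ((2 * n + 1) ^ n * (svf t (T.linear : E n →ₗ[ℝ] E n) /
        (T.linear : E n →ₗ[ℝ] E n).singularValues (⌈t⌉₊ - 1) ^ t)) := by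
  have hm : 0 < ⌈t⌉₊ := Nat.ceil_pos.2 ht
  have hmn : ⌈t⌉₊ ≤ n := Nat.ceil_le.2 htn
  have hσ := singularValues_pos T.linear (show ⌈t⌉₊ - 1 < n by omega)
  set σ := (T.linear : E n →ₗ[ℝ] E n).singularValues (⌈t⌉₊ - 1)
  obtain ⟨Q, hQ, hc⟩ := exists_hypercube_cover (div_pos hδ hσ) hF
  choose p hp using fun i => (hQ i).subset_closedBall
  have hb : ∀ i, Bornology.IsBounded (T '' Metric.closedBall (p i) (n * (δ / σ))) := fun i =>
    ((isCompact_closedBall _ _).image T.continuous_of_finiteDimensional).isBounded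
  have hsub : T '' F ⊆ ⋃ i, T '' Metric.closedBall (p i) (n * (δ / σ)) := by
    rw [← image_iUnion]
    exact image_mono (hc.trans (iUnion_mono hp))
  have hbU : Bornology.IsBounded (⋃ i, T '' Metric.closedBall (p i) (n * (δ / σ))) :=
    (Bornology.isBounded_iUnion).2 hb
  calc (boxCount δ (T '' F) : ℝ)
      ≤ ∑ i, (boxCount δ (T '' Metric.closedBall (p i) (n * (δ / σ))) : ℝ) := by
        exact_mod_cast (boxCount_mono hδ hsub hbU).trans (boxCount_iUnion_le hδ hb)
    _ ≤ ∑ _i : Fin (boxCount (δ / σ) F), (2 * n + 1) ^ n * (svf t _ / σ ^ t) :=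
        Finset.sum_le_sum fun i _ => boxCount_image_closedBall_le_svf hδ T (p i)
          (by positivity) n.cast_nonneg ht htn (le_of_eq (by
            change n * (δ / σ) * σ = n * δ
            field_simp))
    _ = _ := by simp

/-! ### Upper box dimension -/

theorem upperBoxDim_mono {n : ℕ} {F G : Set (E n)} (h : F ⊆ G) (hG : Bornology.IsBounded G) :
    upperBoxDim F ≤ upperBoxDim G := by
  refine limsup_le_limsup ?_
  filter_upwards [Ioo_mem_nhdsGT (zero_lt_one (α := ℝ))] with δ hδ
  have hlog : 0 ≤ -Real.log δ := (neg_pos.2 (Real.log_neg hδ.1 hδ.2)).le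
  refine EReal.coe_le_coe_iff.2 (div_le_div_of_nonneg_right ?_ hlog)
  rcases Nat.eq_zero_or_pos (boxCount δ F) with h0 | h0
  · rw [h0, Nat.cast_zero, Real.log_zero]
    exact Real.log_natCast_nonneg _
  · exact Real.log_le_log (by exact_mod_cast h0) (by exact_mod_cast boxCount_mono hδ.1 h hG)

theorem upperBoxDim_le_of_boxCount_le {n : ℕ} {F : Set (E n)} {K t : ℝ} (ht : 0 ≤ t)
    (h : ∀ δ : ℝ, 0 < δ → δ < 1 → (boxCount δ F : ℝ) ≤ K * δ ^ (-t)) :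
    upperBoxDim F ≤ t := by
  -- Using `max K 1` keeps the logarithm nonnegative, which covers a zero count, where `Real.log 0 =
  -- 0`.
  have hlim : Tendsto (fun δ : ℝ => Real.log (max K 1) / (-Real.log δ) + t) (𝓝[>] 0) (𝓝 t) := by
    have h1 : Tendsto (fun δ : ℝ => -Real.log δ) (𝓝[>] 0) atTop :=
      tendsto_neg_atBot_atTop.comp Real.tendsto_log_nhdsGT_zero
    simpa using (h1.const_div_atTop (Real.log (max K 1))).add_const t
  have hlim' := (continuous_coe_real_ereal.tendsto t).comp hlim
  rw [← hlim'.limsup_eq]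
  refine limsup_le_limsup ?_
  filter_upwards [Ioo_mem_nhdsGT (zero_lt_one (α := ℝ))] with δ hδ
  have hlog : 0 < -Real.log δ := neg_pos.2 (Real.log_neg hδ.1 hδ.2)
  refine EReal.coe_le_coe_iff.2 ?_
  have hK : 0 < max K 1 := lt_max_of_lt_right one_pos
  have hKl : 0 ≤ Real.log (max K 1) := Real.log_nonneg (le_max_right _ _)
  change _ ≤ Real.log (max K 1) / (-Real.log δ) + t
  rw [div_add' _ _ _ hlog.ne']
  refine div_le_div_of_nonneg_right ?_ hlog.le
  rcases Nat.eq_zero_or_pos (boxCount δ F) with h0 | h0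
  · rw [h0, Nat.cast_zero, Real.log_zero]
    positivity
  · have hp : 0 < δ ^ (-t) := Real.rpow_pos_of_pos hδ.1 _
    have h1 : (boxCount δ F : ℝ) ≤ max K 1 * δ ^ (-t) :=
      (h δ hδ.1 hδ.2).trans (mul_le_mul_of_nonneg_right (le_max_left _ _) hp.le)
    refine (Real.log_le_log (by exact_mod_cast h0) h1).trans_eq ?_
    rw [Real.log_mul hK.ne' hp.ne', Real.log_rpow hδ.1]
    ring

/-- The limsup controls only `δ ≤ ε`; between `ε` and one the count is at most that at `ε`. The
whole range up to one is needed because `C` is later covered at scales `δ / σ(w)`, which need not be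
small. -/
theorem exists_boxCount_le_of_upperBoxDim_lt {n : ℕ} {F : Set (E n)}
    (hF : Bornology.IsBounded F) {t : ℝ} (ht : 0 < t) (h : upperBoxDim F < t) :
    ∃ K : ℝ, 0 ≤ K ∧ ∀ δ : ℝ, 0 < δ → δ ≤ 1 → (boxCount δ F : ℝ) ≤ K * δ ^ (-t) := by
  have h1 := (eventually_lt_of_limsup_lt h).and (Ioo_mem_nhdsGT (zero_lt_one (α := ℝ)))
  obtain ⟨ε, hε, hε'⟩ := mem_nhdsGT_iff_exists_Ioc_subset.1 h1
  have hε0 : (0 : ℝ) < ε := hε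
  refine ⟨max 1 (boxCount ε F), by positivity, fun δ h0 hδ => ?_⟩
  have hp : 0 < δ ^ (-t) := Real.rpow_pos_of_pos h0 _
  rcases le_total δ ε with hle | hle
  · obtain ⟨h2, h3⟩ := hε' ⟨h0, hle⟩
    have hlog : 0 < -Real.log δ := neg_pos.2 (Real.log_neg h0 h3.2)
    rw [EReal.coe_lt_coe_iff, div_lt_iff₀ hlog] at h2
    refine le_trans ?_ (le_mul_of_one_le_left hp.le (le_max_left _ _))
    rcases Nat.eq_zero_or_pos (boxCount δ F) with h0' | h0'
    · rw [h0', Nat.cast_zero]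
      exact hp.le
    · rw [← Real.log_le_log_iff (by exact_mod_cast h0') hp, Real.log_rpow h0]
      linarith
  · have h2 : (boxCount δ F : ℝ) ≤ boxCount ε F := by exact_mod_cast boxCount_anti hε0 hle hF
    have h3 : 1 ≤ δ ^ (-t) := Real.one_le_rpow_of_pos_of_le_one_of_nonpos h0 hδ (by linarith)
    exact (h2.trans (le_max_right 1 _)).trans (le_mul_of_one_le_right (by positivity) h3)

/-! ### Attractors -/

section Attractor

variable {n N : ℕ} {S : Fin N → (E n ≃ᵃ[ℝ] E n)} {C F : Set (E n)}

theorem IsAttractor.condensation_subset (h : IsAttractor S C F) : C ⊆ F := by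
  rw [h.2.2]
  exact subset_union_right

theorem IsAttractor.map_mem (h : IsAttractor S C F) {x : E n} (hx : x ∈ F) (i : Fin N) :
    S i x ∈ F := by
  rw [h.2.2]
  exact Or.inl (mem_iUnion.2 ⟨i, x, hx, rfl⟩)

theorem IsAttractor.exists_eq_or_mem (h : IsAttractor S C F) {x : E n} (hx : x ∈ F) :
    (∃ i, ∃ y ∈ F, S i y = x) ∨ x ∈ C := by
  rw [h.2.2] at hx
  simpa only [mem_union, mem_iUnion, mem_image] using hx

/-- The homogeneous attractor is contained in every inhomogeneous one. -/
theorem IsAttractor.homogeneous_subset (hS : IsAffineIFS S) {F₀ : Set (E n)}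
    (h₀ : IsAttractor S ∅ F₀) (h : IsAttractor S C F) : F₀ ⊆ F := by
  -- Write the farthest point as `S i y` with `y` in `F₀`: its distance to `F` is at most `c` times
  -- that of `y`, hence at most `c` times itself.
  obtain ⟨x₀, hx₀, hmax⟩ := h₀.1.exists_isMaxOn h₀.2.1 (Metric.continuous_infDist_pt F).continuousOn
  have hzero : Metric.infDist x₀ F ≤ 0 := by
    obtain ⟨i, y, hy, rfl⟩ := (h₀.exists_eq_or_mem hx₀).resolve_right (notMem_empty _)
    obtain ⟨z, hz, hyz⟩ := h.1.exists_infDist_eq_dist h.2.1 y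
    obtain ⟨c, hc0, hc1, hc⟩ := hS.2 i
    have h1 : Metric.infDist (S i y) F ≤ dist (S i y) (S i z) :=
      Metric.infDist_le_dist_of_mem (h.map_mem hz i)
    have h2 : Metric.infDist y F ≤ Metric.infDist (S i y) F := hmax hy
    have h3 := hc y z
    rw [← hyz] at h3
    have h4 := mul_le_mul_of_nonneg_left h2 hc0.le
    by_contra! hpos
    nlinarith
  intro x hx
  rw [h.1.isClosed.mem_iff_infDist_zero h.2.1]
  have hle : Metric.infDist x F ≤ Metric.infDist x₀ F := hmax hx
  exact le_antisymm (hle.trans hzero) Metric.infDist_nonneg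

/-- There are finitely many letters, so one constant serves all words: a singular value above `δ`
cannot fall below `a * δ` in one step. -/
theorem exists_mul_singularValues_le_snoc (hN : 0 < N) (S : Fin N → (E n ≃ᵃ[ℝ] E n)) {j : ℕ}
    (hj : j < n) :
    ∃ a : ℝ, 0 < a ∧ a ≤ 1 ∧ ∀ {k : ℕ} (w : Fin k → Fin N) (i : Fin N),
      a * ((wordMap S w).linear : E n →ₗ[ℝ] E n).singularValues j ≤
        ((wordMap S (Fin.snoc w i : Fin (k + 1) → Fin N)).linear :
          E n →ₗ[ℝ] E n).singularValues j := by
  choose a ha h using fun i => exists_mul_singularValues_le (S i).linear hj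
  have : Nonempty (Fin N) := ⟨⟨0, hN⟩⟩
  obtain ⟨i₀, hi₀⟩ := Finite.exists_min a
  refine ⟨min (a i₀) 1, lt_min (ha _) one_pos, min_le_right _ _, fun w i => ?_⟩
  rw [wordMap_snoc, linear_mul_toLinearMap]
  exact (mul_le_mul_of_nonneg_right ((min_le_left _ _).trans (hi₀ i))
    (LinearMap.singularValues_nonneg _ _)).trans (h i _)

theorem singularValues_wordMap_zero {j : ℕ} (hj : j < n) (w : Fin 0 → Fin N) :
    ((wordMap S w).linear : E n →ₗ[ℝ] E n).singularValues j = 1 := by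
  obtain ⟨b, hb⟩ := exists_orthonormalBasis_inner_map ((wordMap S w).linear : E n →ₗ[ℝ] E n)
  rw [← norm_map_singular_vector hb ⟨j, hj⟩]
  exact b.norm_eq_one _

/-- The points of the attractor are reached either from the condensation set along a word whose
`j`-th singular value exceeds `δ`, or from the attractor along a word whose `j`-th singular value
is comparable to `δ`. -/
theorem IsAttractor.exists_word (h : IsAttractor S C F) {j : ℕ} (hj : j < n) {a δ : ℝ}
    (haδ : a * δ < 1) (ha : 0 < a)
    (hsnoc : ∀ {k : ℕ} (w : Fin k → Fin N) (i : Fin N),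
      a * ((wordMap S w).linear : E n →ₗ[ℝ] E n).singularValues j ≤
        ((wordMap S (Fin.snoc w i : Fin (k + 1) → Fin N)).linear :
          E n →ₗ[ℝ] E n).singularValues j) (L : ℕ) {x : E n} (hx : x ∈ F) :
    (∃ k < L, ∃ w : Fin k → Fin N,
      (δ < ((wordMap S w).linear : E n →ₗ[ℝ] E n).singularValues j ∧ x ∈ wordMap S w '' C) ∨
      (a * δ < ((wordMap S w).linear : E n →ₗ[ℝ] E n).singularValues j ∧
        ((wordMap S w).linear : E n →ₗ[ℝ] E n).singularValues j ≤ δ ∧ x ∈ wordMap S w '' F)) ∨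
    ∃ w : Fin L → Fin N, a * δ < ((wordMap S w).linear : E n →ₗ[ℝ] E n).singularValues j ∧
      x ∈ wordMap S w '' F := by
  induction L with
  | zero =>
    refine Or.inr ⟨Fin.elim0, ?_, x, hx, rfl⟩
    rwa [singularValues_wordMap_zero hj]
  | succ L ih =>
    rcases ih with ⟨k, hk, hw⟩ | ⟨w, hw, y, hy, rfl⟩
    · exact Or.inl ⟨k, by omega, hw⟩
    · rcases le_or_gt (((wordMap S w).linear : E n →ₗ[ℝ] E n).singularValues j) δ with hle | hlt
      · exact Or.inl ⟨L, by omega, w, Or.inr ⟨hw, hle, y, hy, rfl⟩⟩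
      -- A word is prolonged only while its singular value exceeds `δ`, so the new value still
      -- exceeds `a * δ`.
      · rcases h.exists_eq_or_mem hy with ⟨i, z, hz, rfl⟩ | hyC
        · refine Or.inr ⟨Fin.snoc w i, ?_, z, hz, ?_⟩
          · exact (mul_lt_mul_of_pos_left hlt ha).trans_le (hsnoc w i)
          · rw [wordMap_snoc]
            rfl
        · exact Or.inl ⟨L, by omega, w, Or.inl ⟨hlt, y, hyC, rfl⟩⟩

theorem IsAttractor.exists_boxCount_le (hn : 1 ≤ n) (hS : IsAffineIFS S) (h : IsAttractor S C F)
    {t : ℝ} (ht : 0 < t) (htn : t ≤ n) (hsum : Summable fun k => svfSum S k t)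
    (hCt : upperBoxDim C < t) :
    ∃ K : ℝ, ∀ δ : ℝ, 0 < δ → δ < 1 → (boxCount δ F : ℝ) ≤ K * δ ^ (-t) := by
  have hm : 0 < ⌈t⌉₊ := Nat.ceil_pos.2 ht
  have hmn : ⌈t⌉₊ ≤ n := Nat.ceil_le.2 htn
  have hj : ⌈t⌉₊ - 1 < n := by omega
  have hCb : Bornology.IsBounded C := h.1.isBounded.subset h.condensation_subset
  obtain ⟨K₁, hK₁, hC⟩ := exists_boxCount_le_of_upperBoxDim_lt hCb ht hCt
  obtain ⟨a, ha0, ha1, hsnoc⟩ := exists_mul_singularValues_le_snoc hS.1 S hj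
  obtain ⟨c, hc0, hc1, hc⟩ := hS.exists_norm_linear_le
  obtain ⟨R', hR'⟩ := h.1.isBounded.subset_closedBall 0
  set R := max R' 0
  have hR0 : 0 ≤ R := le_max_right _ _
  have hR : F ⊆ Metric.closedBall 0 R :=
    hR'.trans (Metric.closedBall_subset_closedBall (le_max_left _ _))
  set σ : (Σ k : ℕ, (Fin k → Fin N)) → ℝ := fun p =>
    ((wordMap S p.2).linear : E n →ₗ[ℝ] E n).singularValues (⌈t⌉₊ - 1) with hσdef
  have hσ : ∀ p, 0 < σ p := fun p => singularValues_pos (wordMap S p.2).linear hj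
  -- The first summand pays for images of `C`, the second for images of `F`.
  set K₂ : ℝ := K₁ * (2 * n + 1) ^ n + (2 * R + 1) ^ n * a ^ (-t)
  have hat : 0 < a ^ (-t) := Real.rpow_pos_of_pos ha0 _
  refine ⟨K₂ * ∑' k, svfSum S k t, fun δ hδ0 hδ1 => ?_⟩
  have hδt : 0 < δ ^ (-t) := Real.rpow_pos_of_pos hδ0 _
  have haδ : a * δ < 1 := mul_lt_one_of_nonneg_of_lt_one_right ha1 hδ0.le hδ1
  set Z : (Σ k : ℕ, (Fin k → Fin N)) → Set (E n) := fun p =>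
    if δ < σ p then wordMap S p.2 '' C else if a * δ < σ p then wordMap S p.2 '' F else ∅ with hZ
  have himg : ∀ (T : E n ≃ᵃ[ℝ] E n) {G : Set (E n)}, G ⊆ F → Bornology.IsBounded (T '' G) :=
    fun T G hG => ((h.1.image T.continuous_of_finiteDimensional).isBounded).subset (image_mono hG)
  have hZb : ∀ p, Bornology.IsBounded (Z p) := by
    intro p
    simp only [hZ]
    split_ifs
    · exact himg _ h.condensation_subset
    · exact himg _ Subset.rfl
    · exact Bornology.isBounded_empty
  have hZc : ∀ p, (boxCount δ (Z p) : ℝ) ≤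
      K₂ * δ ^ (-t) * svf t ((wordMap S p.2).linear : E n →ₗ[ℝ] E n) := by
    intro p
    have hv := svf_pos hn t (wordMap S p.2).linear
    have hσt : 0 < σ p ^ t := Real.rpow_pos_of_pos (hσ p) t
    simp only [hZ]
    split_ifs with h1 h2
    -- Since `δ < σ p`, the scale `δ / σ p` is below one and the bound for `C` applies; its factor
    -- `σ p ^ t` cancels the denominator.
    · calc (boxCount δ (wordMap S p.2 '' C) : ℝ)
          ≤ boxCount (δ / σ p) C * ((2 * n + 1) ^ n *
            (svf t ((wordMap S p.2).linear : E n →ₗ[ℝ] E n) / σ p ^ t)) :=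
            boxCount_image_le_svf hδ0 _ hCb ht htn
        _ ≤ K₁ * (δ / σ p) ^ (-t) * ((2 * n + 1) ^ n *
            (svf t ((wordMap S p.2).linear : E n →ₗ[ℝ] E n) / σ p ^ t)) := by
            refine mul_le_mul_of_nonneg_right
              (hC _ (div_pos hδ0 (hσ p)) ((div_le_one (hσ p)).2 h1.le)) (by positivity)
        _ = K₁ * (2 * n + 1) ^ n * δ ^ (-t) *
            svf t ((wordMap S p.2).linear : E n →ₗ[ℝ] E n) := by
            rw [Real.div_rpow hδ0.le (hσ p).le, Real.rpow_neg (hσ p).le]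
            field_simp
        _ ≤ _ := by
            gcongr
            exact le_add_of_nonneg_right (by positivity)
    -- Here `a * δ < σ p ≤ δ`: the upper bound allows `κ = R`, the lower one replaces `σ p ^ t` by
    -- `(a * δ) ^ t`.
    · push Not at h1
      calc (boxCount δ (wordMap S p.2 '' F) : ℝ)
          ≤ boxCount δ (wordMap S p.2 '' Metric.closedBall 0 R) := by
            exact_mod_cast boxCount_mono hδ0 (image_mono hR) ((isCompact_closedBall _ _).image
              (wordMap S p.2).continuous_of_finiteDimensional).isBounded
        _ ≤ (2 * R + 1) ^ n * (svf t ((wordMap S p.2).linear : E n →ₗ[ℝ] E n) / σ p ^ t) :=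
            boxCount_image_closedBall_le_svf hδ0 _ 0 hR0 hR0 ht htn
              (mul_le_mul_of_nonneg_left h1 hR0)
        _ ≤ (2 * R + 1) ^ n * (svf t ((wordMap S p.2).linear : E n →ₗ[ℝ] E n) / (a * δ) ^ t) := by
            have := Real.rpow_pos_of_pos (mul_pos ha0 hδ0) t
            gcongr
        _ = (2 * R + 1) ^ n * a ^ (-t) * δ ^ (-t) *
            svf t ((wordMap S p.2).linear : E n →ₗ[ℝ] E n) := by
            rw [Real.mul_rpow ha0.le hδ0.le, Real.rpow_neg ha0.le, Real.rpow_neg hδ0.le]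
            field_simp
        _ ≤ _ := by
            gcongr
            exact le_add_of_nonneg_left (by positivity)
    · have h0 : boxCount δ (∅ : Set (E n)) = 0 := by
        simpa using boxCount_le_card (δ := δ) (F := (∅ : Set (E n)))
          (Q := fun i : Fin 0 => i.elim0) (fun i => i.elim0) (empty_subset _)
      rw [h0, Nat.cast_zero]
      positivity
  -- At length `L` every singular value is at most `c ^ L < a * δ`, so the unfinished alternative of
  -- `exists_word` is impossible.
  obtain ⟨L, hL⟩ := exists_pow_lt_of_lt_one (mul_pos ha0 hδ0) hc1
  have hcover : F ⊆ ⋃ q : (Σ k : Fin L, (Fin k → Fin N)), Z ⟨q.1, q.2⟩ := by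
    intro x hx
    rcases h.exists_word hj haδ ha0 hsnoc L hx with ⟨k, hk, w, hw⟩ | ⟨w, hw, -⟩
    · refine mem_iUnion.2 ⟨⟨⟨k, hk⟩, w⟩, ?_⟩
      rcases hw with ⟨h1, hxC⟩ | ⟨h1, h2, hxF⟩
      · simp only [hZ]
        rwa [if_pos h1]
      · simp only [hZ]
        rwa [if_neg (not_lt.2 h2), if_pos h1]
    · have := singularValues_le_of_norm_map_le
        (A := ((wordMap S w).linear : E n →ₗ[ℝ] E n)) (norm_wordMap_linear_le hc0.le hc w) hj
      linarith
  calc (boxCount δ F : ℝ)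
      ≤ ∑ q : (Σ k : Fin L, (Fin k → Fin N)), (boxCount δ (Z ⟨q.1, q.2⟩) : ℝ) := by
        exact_mod_cast (boxCount_mono hδ0 hcover
          (Bornology.isBounded_iUnion.2 fun q => hZb _)).trans
          (boxCount_iUnion_le hδ0 fun q => hZb _)
    _ ≤ ∑ q : (Σ k : Fin L, (Fin k → Fin N)),
          K₂ * δ ^ (-t) * svf t ((wordMap S q.2).linear : E n →ₗ[ℝ] E n) :=
        Finset.sum_le_sum fun q _ => hZc ⟨q.1, q.2⟩
    _ = K₂ * δ ^ (-t) * ∑ k ∈ Finset.range L, svfSum S k t := by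
        rw [← Finset.mul_sum, Fintype.sum_sigma, ← Fin.sum_univ_eq_sum_range]
        rfl
    _ ≤ K₂ * δ ^ (-t) * ∑' k, svfSum S k t := by
        gcongr
        exact hsum.sum_le_tsum _ fun k _ => svfSum_nonneg S hn k t
    _ = _ := by ring

/-- A bounded set has upper box dimension at most the dimension of the ambient space. -/
theorem upperBoxDim_le_finrank {F : Set (E n)} (hF : Bornology.IsBounded F) :
    upperBoxDim F ≤ (n : ℝ) := by
  obtain ⟨R', hR'⟩ := hF.subset_closedBall 0
  set R := max R' 0
  have hR0 : 0 ≤ R := le_max_right _ _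
  refine upperBoxDim_le_of_boxCount_le (K := (2 * R + 1) ^ n) n.cast_nonneg fun δ h0 h1 => ?_
  have h2 := boxCount_orthotope_le h0 (EuclideanSpace.basisFun (Fin n) ℝ) 0
    (l := fun _ => R) (fun _ => hR0) (F := F) fun y hy j => by
      have h3 := abs_real_inner_le_norm (EuclideanSpace.basisFun (Fin n) ℝ j) (y - 0)
      rw [OrthonormalBasis.norm_eq_one, one_mul, sub_zero] at h3
      rw [sub_zero]
      exact h3.trans ((by simpa using hR' hy : ‖y‖ ≤ R').trans (le_max_left _ _))
  rw [Finset.prod_const, Finset.card_univ, Fintype.card_fin] at h2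
  refine h2.trans ?_
  rw [Real.rpow_neg h0.le, Real.rpow_natCast, ← div_eq_mul_inv, ← div_pow]
  gcongr
  rw [add_div]
  gcongr
  exact (one_le_div h0).2 h1.le

theorem IsAttractor.upperBoxDim_le (hn : 1 ≤ n) (hS : IsAffineIFS S) (h : IsAttractor S C F)
    {s : ℝ} (hs : IsAffinityDim S s) : upperBoxDim F ≤ max (s : EReal) (upperBoxDim C) := by
  refine EReal.le_of_forall_lt_iff_le.1 fun t ht => ?_
  obtain ⟨hst, hCt⟩ := max_lt_iff.1 ht
  rw [EReal.coe_lt_coe_iff] at hst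
  -- The counting estimate needs an index `⌈t⌉₊ - 1 < n`; for `t ≥ n` the ambient dimension
  -- suffices.
  rcases le_total t n with htn | htn
  · have ht0 : 0 < t := hs.nonneg.trans_lt hst
    obtain ⟨K, hK⟩ := h.exists_boxCount_le hn hS ht0 htn (hs.summable_svfSum hn hS hst) hCt
    exact upperBoxDim_le_of_boxCount_le ht0.le hK
  · exact (upperBoxDim_le_finrank h.1.isBounded).trans (EReal.coe_le_coe_iff.2 htn)

end Attractor

end InhomSelfAffine

theorem theorem2p1 {n N : ℕ} (hn : 1 ≤ n)
    (S : Fin N → (InhomSelfAffine.E n ≃ᵃ[ℝ] InhomSelfAffine.E n))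
    (hS : InhomSelfAffine.IsAffineIFS S)
    (C F₀ FC : Set (InhomSelfAffine.E n)) (hC : IsCompact C)
    (hF₀ : InhomSelfAffine.IsAttractor S ∅ F₀)
    (hFC : InhomSelfAffine.IsAttractor S C FC) :
    (∃! s : ℝ, InhomSelfAffine.IsAffinityDim S s) ∧
    ∀ s : ℝ, InhomSelfAffine.IsAffinityDim S s →
      max (InhomSelfAffine.upperBoxDim F₀) (InhomSelfAffine.upperBoxDim C)
          ≤ InhomSelfAffine.upperBoxDim FC ∧
      InhomSelfAffine.upperBoxDim FC
          ≤ max (s : EReal) (InhomSelfAffine.upperBoxDim C) :=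
  ⟨InhomSelfAffine.existsUnique_isAffinityDim hn hS, fun _ hs =>
    ⟨max_le
      (InhomSelfAffine.upperBoxDim_mono (hF₀.homogeneous_subset hS hFC) hFC.1.isBounded)
      (InhomSelfAffine.upperBoxDim_mono hFC.condensation_subset hFC.1.isBounded),
    hFC.upperBoxDim_le hn hS hs⟩⟩
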